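/- All theories are theories in classical first-order logic with equality, in a language whose symbols are numbered, so that formulas have Gödel numbers (codes). A theory $T$ is *consistent* if $T\nvdash\bot$, and *RE* if the set of codes of its theorems is recursively enumerable (RE); every theory axiomatized by an RE set of sentences in a recursive language is RE. $\mathsf{Num}$ is the theory in the language $\{\mathbf 0,\mathbf S\}$ with axioms $\overline m\neq\overline n$ for all natural numbers $m\ne n$, where $\overline 0=\mathbf 0$ and $\overline{n+1}=\mathbf S\overline n$. A *translation* $I$ of $\{\mathbf 0,\mathbf S\}$ into the language of $T$ consists of formulas $\delta_I(x)$ (domain), $x=_I y$ (equality), $\mathbf 0_I(y)$ and $\mathbf S_I(x,y)$; sentences are translated by unnesting function symbols, replacing atoms by these formulas, and restricting quantifiers to $\delta_I$. It is an *interpretation* $I:\mathsf{Num}\unlhd T$ if $T$ proves that $\mathbf 0_I,\mathbf S_I$ are total on $\delta_I$, the translations of all theorems of $\mathsf{Num}$, and the translated equality axioms. If $T$ is a relational extension of $\mathsf{Num}$ (the function symbols of its language are exactly $\mathbf 0,\mathbf S$, and $T$ proves $\mathsf{Num}$), the only interpretation admitted below is the identity. For a formula $\phi(x_1,\dots,x_n)$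 and $\vec a=(a_1,\dots,a_n)\in\mathbb N^n$, let $\phi(\overline{a_1}^I,\dots,\overline{a_n}^I)$ be the sentence $\exists x_1\cdots\exists x_n\big(\bigwedge_i(\delta_I(x_i)\wedge (\overline{a_i}=x_i)^I)\wedge\phi(x_1,\dots,x_n)\big)$. Let $M_1,M_2\subseteq\mathbb N^n$ be RE. The formula $\phi(x_1,\dots,x_n)$ *strongly separates* $M_1-M_2$ from $M_2-M_1$ in $T$ w.r.t. $I$ if $T\vdash\phi(\overline{a_1}^I,\dots,\overline{a_n}^I)$ for all $\vec a\in M_1-M_2$ and $T\vdash\neg\phi(\overline{a_1}^I,\dots,\overline{a_n}^I)$ for all $\vec a\in M_2-M_1$. If $M_1\cap M_2=\emptyset$, $\phi$ *exactly separates* $M_1$ from $M_2$ in $T$ w.r.t. $I$ if for all $\vec a\in\mathbb N^n$: $\vec a\in M_1\Leftrightarrow T\vdash\phi(\overline{a_1}^I,\dots,\overline{a_n}^I)$ and $\vec a\in M_2\Leftrightarrow T\vdash\neg\phi(\overline{a_1}^I,\dots,\overline{a_n}^I)$. For each $n\ge1$ let $(R^n_i)_{i\in\mathbb N}$ be an acceptable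 listing of the $n$-ary RE relations, i.e. $\{(i,\vec a):\vec a\in R^n_i\}$ is RE, and for every RE relation $M\subseteq\mathbb N\times\mathbb N^n$ there is a recursive $s$ with $R^n_{s(k)}=\{\vec a:(k,\vec a)\in M\}$ for all $k$. For $n\geq 1$, a consistent RE theory $T$ is called - *$n$-Rosser* if there is $I:\mathsf{Num}\unlhd T$ such that for all $n$-ary RE relations $M_1,M_2$ some formula with exactly the $n$ free variables $x_1,\dots,x_n$ strongly separates $M_1-M_2$ from $M_2-M_1$ in $T$ w.r.t. $I$; - *exact $n$-Rosser* if there is $I:\mathsf{Num}\unlhd T$ such that for all disjoint $n$-ary RE relations $M_1,M_2$ some formula with exactly the $n$ free variables $x_1,\dots,x_n$ exactly separates $M_1$ from $M_2$ in $T$ w.r.t. $I$; - *effectively $n$-Rosser* if there are $I:\mathsf{Num}\unlhd T$ and a recursive function $f(i,j)$ such that for all $i,j$, $f(i,j)$ is the code of a formula with exactly the $n$ free variables $x_1,\dots,x_n$ that strongly separates $R^n_i-R^n_j$ from $R^n_j-R^n_i$ in $T$ w.r.t. $I$; - *effectively exact $n$-Rosser* if there are $I:\mathsf{Num}\unlhd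 T$ and a recursive function $f(i,j)$ such that for all $i,j$ with $R^n_i\cap R^n_j=\emptyset$, $f(i,j)$ is the code of a formula with exactly the $n$ free variables $x_1,\dots,x_n$ that exactly separates $R^n_i$ from $R^n_j$ in $T$ w.r.t. $I$. $T$ is *Rosser*, *exact Rosser*, *effectively Rosser*, *effectively exact Rosser* if it has the corresponding $n$-property for every $n\ge1$ (the interpretation may depend on $n$). **Theorem.** For every consistent RE theory $T$ the following are equivalent: (1) $T$ is Rosser; (2) $T$ is effectively Rosser; (3) $T$ is exact Rosser; (4) $T$ is effectively exact Rosser. -/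

import Mathlib

open scoped FirstOrder

universe u v

namespace Rosser

/-! ### First-order syntax: substitution, free variables, Godel numbers

Formulas are Mathlib's bounded formulas. `Fm L n` is the type of `L`-formulas whose free variables
are among `x_0, …, x_{n-1}`; in `Fm L n` a quantifier binds the variable `x_n`. In particular
`Fm L 0` is the type of `L`-sentences. -/

/-- Terms with variables among `x_0, …, x_{n-1}`. -/
abbrev Tm (L : FirstOrder.Language.{u, v}) (n : ℕ) := L.Term (Empty ⊕ Fin n)

/-- Formulas with free variables among `x_0, …, x_{n-1}`. -/
abbrev Fm (L : FirstOrder.Language.{u, v}) (n : ℕ) := L.BoundedFormula Empty n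

section Formulas

variable {L : FirstOrder.Language.{u, v}}

/-- The variable `x_i` as a term. -/
def var {n : ℕ} (i : Fin n) : Tm L n := FirstOrder.Language.Term.var (Sum.inr i)

/-- Simultaneous substitution of `σ i` for `x_i` in a term. -/
def tmSubst {k m : ℕ} (t : Tm L k) (σ : Fin k → Tm L m) : Tm L m :=
  t.subst (Sum.elim Empty.elim σ)

/-- A substitution carried under a quantifier: the newly bound variable is left alone. -/
def liftSubst {k m : ℕ} (σ : Fin k → Tm L m) : Fin (k + 1) → Tm L (m + 1) :=
  Fin.snoc (α := fun _ => Tm L (m + 1))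
    (fun i => tmSubst (σ i) (fun j => var j.castSucc)) (var (Fin.last m))

/-- Simultaneous capture-free substitution of `σ i` for the free variable `x_i` in a formula. -/
def subst : {k : ℕ} → Fm L k → {m : ℕ} → (Fin k → Tm L m) → Fm L m
  | _, .falsum, _, _ => .falsum
  | _, .equal t s, _, σ => .equal (tmSubst t σ) (tmSubst s σ)
  | _, .rel R ts, _, σ => .rel R (fun i => tmSubst (ts i) σ)
  | _, .imp φ ψ, _, σ => .imp (subst φ σ) (subst ψ σ)
  | _, .all φ, _, σ => .all (subst φ (liftSubst σ))

/-- `φ(x_{ρ 0}, …, x_{ρ (k-1)})`. -/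
def rename {k m : ℕ} (φ : Fm L k) (ρ : Fin k → Fin m) : Fm L m :=
  subst φ (fun i => var (ρ i))

/-- A formula in `n` variables regarded as a formula in `n + 1` variables. -/
def weaken {n : ℕ} (φ : Fm L n) : Fm L (n + 1) := rename φ Fin.castSucc

/-- `φ(x_0, …, x_{n-1}, t)`: the term `t` is substituted for the last variable. -/
def instLast {n : ℕ} (φ : Fm L (n + 1)) (t : Tm L n) : Fm L n :=
  subst φ (Fin.snoc (α := fun _ => Tm L n) var t)

/-- `x_i` occurs in the term. -/
def TmOccurs {n : ℕ} (i : Fin n) : Tm L n → Prop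
  | .var x => x = Sum.inr i
  | .func _ ts => ∃ j, TmOccurs i (ts j)

/-- `x_i` occurs free in the formula. -/
def Occurs : {n : ℕ} → Fin n → Fm L n → Prop
  | _, _, .falsum => False
  | _, i, .equal t s => TmOccurs i t ∨ TmOccurs i s
  | _, i, .rel _ ts => ∃ j, TmOccurs i (ts j)
  | _, i, .imp φ ψ => Occurs i φ ∨ Occurs i ψ
  | _, i, .all φ => Occurs i.castSucc φ

/-- The formula `φ(x_0, …, x_{n-1})` has exactly the `n` free variables `x_0, …, x_{n-1}`. -/
def HasExactlyFree {n : ℕ} (φ : Fm L n) : Prop := ∀ i, Occurs i φ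

/-- `∃ x_m … ∃ x_{m+l-1} φ`. -/
def exN {m : ℕ} : (l : ℕ) → Fm L (m + l) → Fm L m
  | 0, φ => φ
  | l + 1, φ => exN l φ.ex

/-- The conjunction of finitely many formulas. -/
def conj {m l : ℕ} (f : Fin l → Fm L m) : Fm L m :=
  (List.ofFn f).foldr (fun φ ψ => φ ⊓ ψ) ⊤

/-- Godel numbers of terms, relative to a numbering of the symbols. -/
def tmCode [∀ k, Encodable (L.Functions k)] {n : ℕ} : Tm L n → ℕ
  | .var (Sum.inr i) => Nat.pair 0 i
  | .func (l := l) f ts =>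
      Nat.pair 1 (Nat.pair l (Nat.pair (Encodable.encode f)
        (Encodable.encode (List.ofFn fun i => tmCode (ts i)))))

/-- Godel numbers of formulas, relative to a numbering of the symbols. -/
def code [∀ k, Encodable (L.Functions k)] [∀ k, Encodable (L.Relations k)] :
    {n : ℕ} → Fm L n → ℕ
  | _, .falsum => Nat.pair 0 0
  | _, .equal t s => Nat.pair 1 (Nat.pair (tmCode t) (tmCode s))
  | _, .rel (l := l) R ts =>
      Nat.pair 2 (Nat.pair l (Nat.pair (Encodable.encode R)
        (Encodable.encode (List.ofFn fun i => tmCode (ts i)))))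
  | _, .imp φ ψ => Nat.pair 3 (Nat.pair (code φ) (code ψ))
  | _, .all φ => Nat.pair 4 (code φ)

theorem tmCode_injective [∀ k, Encodable (L.Functions k)] {n : ℕ} :
    Function.Injective (tmCode : Tm L n → ℕ) := by
  intro t
  induction t with
  | var x =>
    rcases x with e | i
    · exact e.elim
    · intro s h
      rcases s with (e | j) | ⟨g, ss⟩
      · exact e.elim
      · simp only [tmCode, Nat.pair_eq_pair, true_and] at h
        rw [Fin.ext h]
      · simp [tmCode, Nat.pair_eq_pair] at h
  | func f ts ih =>
    intro s h
    rcases s with (e | j) | ⟨g, ss⟩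
    · exact e.elim
    · simp [tmCode, Nat.pair_eq_pair] at h
    · simp only [tmCode, Nat.pair_eq_pair, true_and] at h
      obtain ⟨rfl, h1, h2⟩ := h
      have h1 := Encodable.encode_injective h1
      have h2 := List.ofFn_injective (Encodable.encode_injective h2)
      subst h1
      congr 1
      funext i
      exact ih i (congrFun h2 i)

theorem code_injective [∀ k, Encodable (L.Functions k)] [∀ k, Encodable (L.Relations k)]
    {n : ℕ} : Function.Injective (code : Fm L n → ℕ) := by
  intro φ
  induction φ with
  | falsum =>
    intro ψ h
    cases ψ <;> simp [code, Nat.pair_eq_pair] at h ⊢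
  | equal t s =>
    intro ψ h
    cases ψ <;> simp only [code, Nat.pair_eq_pair] at h <;> try omega
    rw [tmCode_injective h.2.1, tmCode_injective h.2.2]
  | rel R ts =>
    intro ψ h
    cases ψ <;> simp only [code, Nat.pair_eq_pair] at h <;> try omega
    obtain ⟨-, rfl, h1, h2⟩ := h
    have h1 := Encodable.encode_injective h1
    have h2 := List.ofFn_injective (Encodable.encode_injective h2)
    subst h1
    congr 1
    funext i
    exact tmCode_injective (congrFun h2 i)
  | imp a b iha ihb =>
    intro ψ h
    cases ψ <;> simp only [code, Nat.pair_eq_pair] at h <;> try omega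
    rw [iha h.2.1, ihb h.2.2]
  | all a ih =>
    intro ψ h
    cases ψ <;> simp only [code, Nat.pair_eq_pair] at h <;> try omega
    rw [ih h.2]

/-! ### Provability -/

/-- Natural deduction for classical first-order logic with equality: `Derives T Γ φ` means that
`φ` is derivable from the axioms `T` and the open assumptions `Γ`, all free variables being among
`x_0, …, x_{n-1}`. -/
inductive Derives (T : L.Theory) : {n : ℕ} → List (Fm L n) → Fm L n → Prop
  | ax {n : ℕ} {Γ : List (Fm L n)} {σ : L.Sentence} (h : σ ∈ T) :
      Derives T Γ (rename (k := 0) (m := n) σ Fin.elim0)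
  | hyp {n : ℕ} {Γ : List (Fm L n)} {φ : Fm L n} (h : φ ∈ Γ) : Derives T Γ φ
  | impI {n : ℕ} {Γ : List (Fm L n)} {φ ψ : Fm L n} (h : Derives T (φ :: Γ) ψ) :
      Derives T Γ (φ.imp ψ)
  | impE {n : ℕ} {Γ : List (Fm L n)} {φ ψ : Fm L n} (h₁ : Derives T Γ (φ.imp ψ))
      (h₂ : Derives T Γ φ) : Derives T Γ ψ
  | raa {n : ℕ} {Γ : List (Fm L n)} {φ : Fm L n} (h : Derives T (φ.not :: Γ) ⊥) : Derives T Γ φ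
  | allI {n : ℕ} {Γ : List (Fm L n)} {φ : Fm L (n + 1)} (h : Derives T (Γ.map weaken) φ) :
      Derives T Γ φ.all
  | allE {n : ℕ} {Γ : List (Fm L n)} {φ : Fm L (n + 1)} (h : Derives T Γ φ.all) (t : Tm L n) :
      Derives T Γ (instLast φ t)
  | eqI {n : ℕ} {Γ : List (Fm L n)} (t : Tm L n) : Derives T Γ (.equal t t)
  | eqE {n : ℕ} {Γ : List (Fm L n)} {t s : Tm L n} (φ : Fm L (n + 1))
      (h₁ : Derives T Γ (.equal t s)) (h₂ : Derives T Γ (instLast φ t)) :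
      Derives T Γ (instLast φ s)
  /-- The universe is not empty. -/
  | nonempty {n : ℕ} {Γ : List (Fm L n)} : Derives T Γ (FirstOrder.Language.BoundedFormula.ex ⊤)

/-- `T ⊢ σ`. -/
def Provable (T : L.Theory) (σ : L.Sentence) : Prop := Derives T (n := 0) [] σ

/-- `T` is consistent. -/
def Consistent (T : L.Theory) : Prop := ¬ Provable T ⊥

/-- `T` is recursively enumerable: the set of Godel numbers of its theorems is. -/
def IsRETheory [∀ k, Encodable (L.Functions k)] [∀ k, Encodable (L.Relations k)]
    (T : L.Theory) : Prop :=
  REPred fun c : ℕ => ∃ σ : L.Sentence, Provable T σ ∧ code (n := 0) σ = c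

end Formulas

/-! ### Translations and interpretations -/

/-- A translation of the language `L₁` into the language `L₂`. -/
structure Translation (L₁ : FirstOrder.Language.{0, 0}) (L₂ : FirstOrder.Language.{u, v}) where
  /-- the domain formula `δ(x_0)` -/
  dom : Fm L₂ 1
  /-- the translation of `x_0 = x_1` -/
  eq : Fm L₂ 2
  /-- the translation of `R(x_0, …, x_{k-1})` -/
  rel : {k : ℕ} → L₁.Relations k → Fm L₂ k
  /-- the translation of `F(x_0, …, x_{k-1}) = x_k` -/
  func : {k : ℕ} → L₁.Functions k → Fm L₂ (k + 1)

namespace Translation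

variable {L₁ : FirstOrder.Language.{0, 0}} {L₂ : FirstOrder.Language.{u, v}} (I : Translation L₁ L₂)

/-- `δ(x_i)`. -/
def domAt {m : ℕ} (i : Fin m) : Fm L₂ m := rename I.dom ![i]

/-- `x_i =_I x_j`. -/
def eqAt {m : ℕ} (i j : Fin m) : Fm L₂ m := rename I.eq ![i, j]

/-- The translation of `t = x_y`, where the variable `x_i` of `t` is replaced by `x_{ρ i}`; the
nested function symbols are removed by
`F(t_1, …, t_l) = y ↔ ∃ z_1 … z_l (t_1 = z_1 ∧ … ∧ t_l = z_l ∧ F(z_1, …, z_l) = y)`. -/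
def graph {k : ℕ} : Tm L₁ k → {m : ℕ} → (Fin k → Fin m) → Fin m → Fm L₂ m
  | .var (Sum.inr x), _, ρ, y => I.eqAt (ρ x) y
  | .func (l := l) F ts, m, ρ, y =>
      exN l (conj (fun j : Fin l => I.domAt (Fin.natAdd m j) ⊓
          graph (ts j) (fun i => Fin.castAdd l (ρ i)) (Fin.natAdd m j)) ⊓
        rename (I.func F)
          (Fin.snoc (α := fun _ => Fin (m + l)) (fun j => Fin.natAdd m j) (Fin.castAdd l y)))

/-- The translation of a formula, where the free variable `x_i` is replaced by `x_{ρ i}`. -/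
def tr : {k : ℕ} → Fm L₁ k → {m : ℕ} → (Fin k → Fin m) → Fm L₂ m
  | _, .falsum, _, _ => .falsum
  | _, .equal t s, m, ρ =>
      let a : Fin (m + 2) := (Fin.last m).castSucc
      let b : Fin (m + 2) := Fin.last (m + 1)
      exN 2 ((I.domAt a ⊓ I.graph t (fun i => (ρ i).castSucc.castSucc) a) ⊓
        ((I.domAt b ⊓ I.graph s (fun i => (ρ i).castSucc.castSucc) b) ⊓ I.eqAt a b))
  | _, .rel (l := l) R ts, m, ρ =>
      exN l (conj (fun j : Fin l => I.domAt (Fin.natAdd m j) ⊓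
          I.graph (ts j) (fun i => Fin.castAdd l (ρ i)) (Fin.natAdd m j)) ⊓
        rename (I.rel R) (fun j => Fin.natAdd m j))
  | _, .imp φ ψ, _, ρ => .imp (tr φ ρ) (tr ψ ρ)
  | _, .all φ, m, ρ =>
      .all ((I.domAt (Fin.last m)).imp
        (tr φ (Fin.snoc (α := fun _ => Fin (m + 1)) (fun i => (ρ i).castSucc) (Fin.last m))))

/-- The translation of a sentence. -/
def trSentence (σ : L₁.Sentence) : L₂.Sentence := I.tr (k := 0) (m := 0) σ Fin.elim0

/-- `F_I` is total on the domain: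
`∀ x (δ(x_0) ∧ … ∧ δ(x_{k-1}) → ∃ y (δ(y) ∧ F_I(x_0, …, x_{k-1}, y)))`. -/
def totality {k : ℕ} (F : L₁.Functions k) : L₂.Sentence :=
  ((conj fun i : Fin k => I.domAt i).imp
    (FirstOrder.Language.BoundedFormula.ex (I.domAt (Fin.last k) ⊓ I.func F))).alls

/-- `φ` respects `=_I` on the domain:
`∀ x ∀ y (⋀ i, (δ(x_i) ∧ δ(y_i) ∧ x_i =_I y_i) → φ(x) → φ(y))`. -/
def congruence {k : ℕ} (φ : Fm L₂ k) : L₂.Sentence :=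
  ((conj fun i : Fin k => I.domAt (Fin.castAdd k i) ⊓
      (I.domAt (Fin.natAdd k i) ⊓ I.eqAt (Fin.castAdd k i) (Fin.natAdd k i))).imp
    ((rename φ (Fin.castAdd k)).imp (rename φ (Fin.natAdd k)))).alls

end Translation

/-- `I` is an interpretation of `T₁` in `T₂`: `T₂` proves the totality of the function symbols, the
translations of all theorems of `T₁`, and the translated axioms of equality. -/
structure IsInterpretation {L₁ : FirstOrder.Language.{0, 0}} {L₂ : FirstOrder.Language.{u, v}}
    (I : Translation L₁ L₂) (T₁ : L₁.Theory) (T₂ : L₂.Theory) : Prop where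
  total : ∀ {k : ℕ} (F : L₁.Functions k), Provable T₂ (I.totality F)
  theorems : ∀ σ : L₁.Sentence, Provable T₁ σ → Provable T₂ (I.trSentence σ)
  eq_refl : Provable T₂ (FirstOrder.Language.BoundedFormula.alls (n := 1)
    ((I.domAt 0).imp (I.eqAt 0 0)))
  eq_symm : Provable T₂ (FirstOrder.Language.BoundedFormula.alls (n := 2)
    ((I.domAt 0).imp ((I.domAt 1).imp ((I.eqAt 0 1).imp (I.eqAt 1 0)))))
  eq_trans : Provable T₂ (FirstOrder.Language.BoundedFormula.alls (n := 3)
    ((I.domAt 0).imp ((I.domAt 1).imp ((I.domAt 2).imp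
      ((I.eqAt 0 1).imp ((I.eqAt 1 2).imp (I.eqAt 0 2)))))))
  rel_congr : ∀ {k : ℕ} (R : L₁.Relations k), Provable T₂ (I.congruence (I.rel R))
  func_congr : ∀ {k : ℕ} (F : L₁.Functions k), Provable T₂ (I.congruence (I.func F))

/-- The translation that replaces every symbol by its image under a map of languages, leaving
equality and the quantifiers unchanged. For an inclusion of languages it is the identity
translation. -/
def identityTranslation {L₁ : FirstOrder.Language.{0, 0}} {L₂ : FirstOrder.Language.{u, v}} (ι : L₁ →ᴸ L₂) :
    Translation L₁ L₂ where
  dom := .equal (var 0) (var 0)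
  eq := .equal (var 0) (var 1)
  rel R := .rel (ι.onRelation R) (fun i => var i)
  func F := .equal (.func (ι.onFunction F) (fun i => var i.castSucc)) (var (Fin.last _))

/-! ### The theory of numerals -/

/-- The function symbols `0` and `S`. -/
inductive NumFunc : ℕ → Type
  | zero : NumFunc 0
  | succ : NumFunc 1

/-- The language `{0, S}`. -/
def numLang : FirstOrder.Language.{0, 0} := ⟨NumFunc, fun _ => Empty⟩

/-- The numeral `S … S 0`. -/
def numeral : ℕ → Tm numLang 0
  | 0 => .func (L := numLang) NumFunc.zero Fin.elim0
  | m + 1 => .func (L := numLang) NumFunc.succ (fun _ => numeral m)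

/-- The theory `Num`: distinct numbers have distinct numerals. -/
def Num : numLang.Theory :=
  {σ | ∃ m n : ℕ, m ≠ n ∧
    σ = FirstOrder.Language.BoundedFormula.not (.equal (numeral m) (numeral n))}

section Theories

variable {L : FirstOrder.Language.{u, v}}

/-- `T` is a relational extension of `Num` via `ι`: the function symbols of its language are exactly
`0` and `S`, and `T` proves the axioms of `Num`. -/
def IsRelationalExtension (T : L.Theory) (ι : numLang →ᴸ L) : Prop :=
  (∀ k : ℕ, Function.Bijective (fun F : numLang.Functions k => ι.onFunction F)) ∧
    ∀ σ ∈ Num, Provable T (ι.onSentence σ)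

/-- The interpretations of `Num` in `T` that are admitted as witnesses: any interpretation of `Num`
in `T`, but only the identity if `T` is a relational extension of `Num`. -/
def IsWitness (T : L.Theory) (I : Translation numLang L) : Prop :=
  IsInterpretation I Num T ∧
    ∀ ι : numLang →ᴸ L, IsRelationalExtension T ι → I = identityTranslation ι

/-- `∃ x_n (δ_I(x_n) ∧ x_n = a^I ∧ φ(x_0, …, x_n))`, that is, `φ(x_0, …, x_{n-1}, a^I)`. -/
def instNumeral (I : Translation numLang L) {n : ℕ} (φ : Fm L (n + 1)) (a : ℕ) : Fm L n :=
  FirstOrder.Language.BoundedFormula.ex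
    ((I.domAt (Fin.last n) ⊓ I.graph (numeral a) Fin.elim0 (Fin.last n)) ⊓ φ)

/-- The sentence `φ(a_0^I, …, a_{n-1}^I)` obtained by putting the interpreted numerals of
`a_0, …, a_{n-1}` for the free variables. -/
def atNumerals (I : Translation numLang L) : {n : ℕ} → Fm L n → (Fin n → ℕ) → L.Sentence
  | 0, φ, _ => φ
  | n + 1, φ, a => atNumerals I (instNumeral I φ (a (Fin.last n))) (fun i => a i.castSucc)

/-- `φ` strongly separates `M₁ - M₂` from `M₂ - M₁` in `T` with respect to `I`. -/
def StronglySeparates (T : L.Theory) (I : Translation numLang L) {n : ℕ} (φ : Fm L n)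
    (M₁ M₂ : Set (Fin n → ℕ)) : Prop :=
  (∀ a ∈ M₁ \ M₂, Provable T (atNumerals I φ a)) ∧
    ∀ a ∈ M₂ \ M₁, Provable T (atNumerals I φ a).not

/-- `φ` exactly separates `M₁` from `M₂` in `T` with respect to `I`. -/
def ExactlySeparates (T : L.Theory) (I : Translation numLang L) {n : ℕ} (φ : Fm L n)
    (M₁ M₂ : Set (Fin n → ℕ)) : Prop :=
  (∀ a, a ∈ M₁ ↔ Provable T (atNumerals I φ a)) ∧
    ∀ a, a ∈ M₂ ↔ Provable T (atNumerals I φ a).not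

/-- An `n`-ary RE relation. -/
def IsRE {n : ℕ} (M : Set (Fin n → ℕ)) : Prop := REPred fun a => a ∈ M

/-- `R 0, R 1, …` is an acceptable listing of the `n`-ary RE relations: the relations `R i` are RE
uniformly in `i`, and an index of the section of an RE relation at `k` can be computed from `k`
(s-m-n property). In particular every `n`-ary RE relation is some `R i`. -/
structure IsAcceptableListing {n : ℕ} (R : ℕ → Set (Fin n → ℕ)) : Prop where
  uniformly_re : REPred fun p : ℕ × (Fin n → ℕ) => p.2 ∈ R p.1
  smn : ∀ M : ℕ × (Fin n → ℕ) → Prop, REPred M →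
    ∃ s : ℕ → ℕ, Computable s ∧ ∀ k, R (s k) = {a | M (k, a)}

/-- `T` is `n`-Rosser. -/
def NRosser (n : ℕ) (T : L.Theory) : Prop :=
  ∃ I : Translation numLang L, IsWitness T I ∧
    ∀ M₁ M₂ : Set (Fin n → ℕ), IsRE M₁ → IsRE M₂ →
      ∃ φ : Fm L n, HasExactlyFree φ ∧ StronglySeparates T I φ M₁ M₂

/-- `T` is exact `n`-Rosser. -/
def ExactNRosser (n : ℕ) (T : L.Theory) : Prop :=
  ∃ I : Translation numLang L, IsWitness T I ∧
    ∀ M₁ M₂ : Set (Fin n → ℕ), IsRE M₁ → IsRE M₂ → Disjoint M₁ M₂ →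
      ∃ φ : Fm L n, HasExactlyFree φ ∧ ExactlySeparates T I φ M₁ M₂

/-- `T` is effectively `n`-Rosser (`R` is the listing of the `n`-ary RE relations). -/
def EffectivelyNRosser [∀ k, Encodable (L.Functions k)] [∀ k, Encodable (L.Relations k)]
    {n : ℕ} (R : ℕ → Set (Fin n → ℕ)) (T : L.Theory) : Prop :=
  ∃ I : Translation numLang L, IsWitness T I ∧
    ∃ f : ℕ → ℕ → ℕ, Computable₂ f ∧ ∀ i j,
      ∃ φ : Fm L n, f i j = code φ ∧ HasExactlyFree φ ∧ StronglySeparates T I φ (R i) (R j)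

/-- `T` is effectively exact `n`-Rosser (`R` is the listing of the `n`-ary RE relations). -/
def EffectivelyExactNRosser [∀ k, Encodable (L.Functions k)] [∀ k, Encodable (L.Relations k)]
    {n : ℕ} (R : ℕ → Set (Fin n → ℕ)) (T : L.Theory) : Prop :=
  ∃ I : Translation numLang L, IsWitness T I ∧
    ∃ f : ℕ → ℕ → ℕ, Computable₂ f ∧ ∀ i j, Disjoint (R i) (R j) →
      ∃ φ : Fm L n, f i j = code φ ∧ HasExactlyFree φ ∧ ExactlySeparates T I φ (R i) (R j)

/-- `T` is Rosser. -/
def IsRosser (T : L.Theory) : Prop := ∀ n : ℕ, 1 ≤ n → NRosser n T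

/-- `T` is exact Rosser. -/
def IsExactRosser (T : L.Theory) : Prop := ∀ n : ℕ, 1 ≤ n → ExactNRosser n T

/-- `T` is effectively Rosser (`R n` is the listing of the `n`-ary RE relations). -/
def IsEffectivelyRosser [∀ k, Encodable (L.Functions k)] [∀ k, Encodable (L.Relations k)]
    (R : (n : ℕ) → ℕ → Set (Fin n → ℕ)) (T : L.Theory) : Prop :=
  ∀ n : ℕ, 1 ≤ n → EffectivelyNRosser (R n) T

/-- `T` is effectively exact Rosser (`R n` is the listing of the `n`-ary RE relations). -/
def IsEffectivelyExactRosser [∀ k, Encodable (L.Functions k)]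
    [∀ k, Encodable (L.Relations k)]
    (R : (n : ℕ) → ℕ → Set (Fin n → ℕ)) (T : L.Theory) : Prop :=
  ∀ n : ℕ, 1 ≤ n → EffectivelyExactNRosser (R n) T

end Theories

end Rosser

/-! Two devices carry the proof, and both trade arity for strength. The trade is affordable because
the properties are assumed for every arity, and the same interpretation serves before and after.

Effectiveness comes from parametrization. The relations `a ∈ R i` and `a ∈ R j` in the arguments
`(a, i, j)` are RE, so one formula in `n + 2` variables separates them. Putting the numerals of `j`
and `i` for its last two variables gives a separator of `R i` and `R j`, whose code is computable
from `i` and `j` (`NRosser.effectivelyNRosser`). In the exact case the universal pair overlaps, so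
it is first made disjoint by reduction. This leaves the sections at disjoint `R i`, `R j` unchanged
(`ExactNRosser.effectivelyExactNRosser`).

Exactness comes from self-reference (`NRosser.exactNRosser`). Let `φ` strongly separate `M₁ ∪ {a : T
⊢ ¬φ(a)}` from `M₂ ∪ {a : T ⊢ φ(a)}`, with `M₁`, `M₂` disjoint. A member of `M₁` at which `φ` is not
provable would lie on the first side only, making `φ` provable there after all. A provable instance
outside `M₁` would lie on the second side only, hence be refutable, against consistency. The other
half is symmetric. Such a `φ` is obtained by separating relations with one more argument `e`, read
as the code of a formula, and then putting the separator's own code for `e`. Neither a fixed-point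
lemma in `T` nor any arithmetic beyond substituting numerals is needed.

Conversely, exact separation of a reduced pair gives strong separation of the original one
(`ExactNRosser.nRosser`). -/

namespace Rosser

/-! ### Recursion-theoretic preliminaries -/

section Recursion

variable {α β : Type*} [Primcodable α] [Primcodable β]

theorem primrec_pi {σ : Type*} [Primcodable σ] {n : ℕ} {f : α → Fin n → σ}
    (h : ∀ i, Primrec fun a => f a i) : Primrec f :=
  Primrec.fin_curry.2 ((Primrec.fin_curry₁ (f := fun i a => f a i)).2 h).swap

theorem primrec_apply {n : ℕ} (i : Fin n) : Primrec fun a : Fin n → ℕ => a i :=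
  Primrec.fin_app.comp .id (.const i)

theorem primrec_init {n : ℕ} : Primrec fun (a : Fin (n + 1) → ℕ) (i : Fin n) => a i.castSucc :=
  primrec_pi fun i => primrec_apply i.castSucc

theorem primrec_snoc {n : ℕ} {f : α → Fin n → ℕ} {g : α → ℕ} (hf : Primrec f) (hg : Primrec g) :
    Primrec fun a => (Fin.snoc (α := fun _ => ℕ) (f a) (g a) : Fin (n + 1) → ℕ) := by
  refine primrec_pi fun i => ?_
  refine Fin.lastCases ?_ (fun i => ?_) i
  · simpa using hg
  · simpa using (primrec_apply i).comp hf

theorem REPred.comp {p : β → Prop} {f : α → β} (hp : REPred p) (hf : Computable f) :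
    REPred fun a => p (f a) :=
  Partrec.comp (f := fun b => Part.assert (p b) fun _ => Part.some ()) hp hf

theorem REPred.or {p q : α → Prop} (hp : REPred p) (hq : REPred q) :
    REPred fun a => p a ∨ q a := by
  obtain ⟨k, hk, h⟩ := Partrec.merge' hp hq
  refine (Partrec.dom_re hk).of_eq fun a => ?_
  rw [(h a).2]
  simp [Part.assert]

/-- The reduction principle for recursively enumerable predicates. -/
theorem REPred.exists_reduction {p q : α → Prop} (hp : REPred p) (hq : REPred q) :
    ∃ p' q' : α → Prop, REPred p' ∧ REPred q' ∧ (∀ a, p' a → p a) ∧ (∀ a, q' a → q a) ∧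
      (∀ a, p' a → ¬ q' a) ∧ ∀ a, p a ∨ q a → p' a ∨ q' a := by
  -- Both semidecision procedures are run in parallel, and the tag in the answer says which one
  -- supplied it. Single-valuedness of `k` makes the reduced predicates disjoint.
  obtain ⟨k, hk, h⟩ := Partrec.merge' (hp.map (Computable.const true).to₂)
    (hq.map (Computable.const false).to₂)
  have key : ∀ b : Bool, REPred fun a => b ∈ k a := fun b => by
    have h1 : Partrec fun a => (k a).bind fun c =>
        (↑(if c = b then some () else none) : Part Unit) :=
      hk.bind (Computable.ofOption
        ((Primrec.dom_finite fun c : Bool => if c = b then some () else none).to_comp.comp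
          Computable.snd)).to₂
    refine (Partrec.dom_re h1).of_eq fun a => ?_
    constructor
    · rintro ⟨hd, hd'⟩
      refine ⟨hd, ?_⟩
      by_contra hne
      simp [hne] at hd'
    · rintro ⟨hd, rfl⟩
      exact ⟨hd, by simp⟩
  refine ⟨fun a => true ∈ k a, fun a => false ∈ k a, key true, key false, ?_, ?_, ?_, ?_⟩
  · intro a ha
    simpa [Part.assert] using (h a).1 _ ha
  · intro a ha
    simpa [Part.assert] using (h a).1 _ ha
  · intro a h1 h2
    exact Bool.noConfusion (Part.mem_unique h1 h2)
  · intro a ha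
    have hd : (k a).Dom := (h a).2.2 (by simpa [Part.assert] using ha)
    cases hb : (k a).get hd
    · exact Or.inr ⟨hd, hb⟩
    · exact Or.inl ⟨hd, hb⟩

/-- Every recursively enumerable relation occurs in an acceptable listing. -/
theorem IsAcceptableListing.exists_eq {n : ℕ} {R : ℕ → Set (Fin n → ℕ)}
    (hR : IsAcceptableListing R) {M : Set (Fin n → ℕ)} (hM : IsRE M) : ∃ i, R i = M := by
  -- The family is constant in its parameter, so any value of `s` is an index of `M`.
  obtain ⟨s, -, hs⟩ := hR.smn (fun p => p.2 ∈ M) (REPred.comp hM Computable.snd)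
  exact ⟨s 0, hs 0⟩

end Recursion

/-! ### Codes of formulas -/

section Codes

variable {L : FirstOrder.Language.{u, v}}

theorem liftSubst_var {k m : ℕ} (ρ : Fin k → Fin m) :
    liftSubst (L := L) (fun i => var (ρ i)) =
      fun i => var (Fin.snoc (α := fun _ => Fin (m + 1)) (fun j => (ρ j).castSucc)
        (Fin.last m) i) := by
  funext i
  refine Fin.lastCases ?_ (fun i => ?_) i
  · simp [liftSubst]
  · simp [liftSubst, tmSubst, var, FirstOrder.Language.Term.subst]

theorem rename_all {k m : ℕ} (φ : Fm L (k + 1)) (ρ : Fin k → Fin m) :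
    rename (FirstOrder.Language.BoundedFormula.all φ) ρ =
      (rename φ (Fin.snoc (α := fun _ => Fin (m + 1)) (fun j => (ρ j).castSucc)
        (Fin.last m))).all := by
  simp only [rename, subst, liftSubst_var]

theorem graph_func (I : Translation numLang L) {k l m : ℕ} (F : numLang.Functions l) (ts : Fin l → Tm numLang k)
    (ρ : Fin k → Fin m) (y : Fin m) :
    I.graph (.func F ts) ρ y =
      exN l (conj (fun j : Fin l => I.domAt (Fin.natAdd m j) ⊓
          I.graph (ts j) (fun i => Fin.castAdd l (ρ i)) (Fin.natAdd m j)) ⊓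
        rename (I.func F)
          (Fin.snoc (α := fun _ => Fin (m + l)) (fun j => Fin.natAdd m j) (Fin.castAdd l y))) := by
  rw [Translation.graph]

theorem graph_numeral_zero (I : Translation numLang L) {m : ℕ} (y : Fin m) :
    I.graph (numeral 0) Fin.elim0 y =
      (⊤ : Fm L m) ⊓ rename (I.func (L₁ := numLang) NumFunc.zero) (fun _ => y) := by
  refine (graph_func I (L := L) (F := (NumFunc.zero : numLang.Functions 0)) _ _ y).trans ?_
  have h : (Fin.snoc (α := fun _ => Fin (m + 0)) (fun j : Fin 0 => Fin.natAdd m j)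
      (Fin.castAdd 0 y)) = fun _ => y := by
    funext i
    fin_cases i
    rfl
  rw [h]
  rfl

/-- Unnesting one `S` leaves the graph of `numeral a` in a context with one more variable, its value
being that new variable. Recursion on `a` therefore shifts `m`. The inner `⊤` is the empty tail of
`conj`. -/
theorem graph_numeral_succ (I : Translation numLang L) (a : ℕ) {m : ℕ} (y : Fin m) :
    I.graph (numeral (a + 1)) Fin.elim0 y =
      (((I.domAt (Fin.last m) ⊓ I.graph (numeral a) Fin.elim0 (Fin.last m)) ⊓ ⊤) ⊓
        rename (I.func (L₁ := numLang) NumFunc.succ) ![Fin.last m, y.castSucc]).ex := by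
  refine (graph_func I (L := L) (F := (NumFunc.succ : numLang.Functions 1)) _ _ y).trans ?_
  have h : (Fin.snoc (α := fun _ => Fin (m + 1)) (fun j : Fin 1 => Fin.natAdd m j)
      (Fin.castAdd 1 y)) = ![Fin.last m, y.castSucc] := by
    funext i
    fin_cases i <;> rfl
  have h' : (fun i : Fin 0 => Fin.castAdd 1 (Fin.elim0 i : Fin m)) = Fin.elim0 :=
    Subsingleton.elim _ _
  rw [h, h']
  simp only [conj, List.ofFn_succ, List.ofFn_zero, List.foldr]
  rfl

/-! ### Codes of renamed formulas -/

variable [∀ k, Encodable (L.Functions k)]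

theorem primrec_tmCode_rename {k : ℕ} (t : Tm L k) :
    ∃ F : (Fin k → ℕ) → ℕ, Primrec F ∧ ∀ (m : ℕ) (ρ : Fin k → Fin m),
      tmCode (tmSubst t fun i => var (ρ i)) = F fun i => ρ i := by
  induction t with
  | var x =>
    rcases x with e | i
    · exact e.elim
    · exact ⟨fun r => Nat.pair 0 (r i),
        Primrec₂.natPair.comp (.const 0) (primrec_apply i), fun m ρ => rfl⟩
  | @func l f ts ih =>
    choose F hF h using ih
    refine ⟨fun r => Nat.pair 1 (Nat.pair l (Nat.pair (Encodable.encode f)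
      (Encodable.encode (List.ofFn fun i => F i r)))), ?_, fun m ρ => ?_⟩
    · exact Primrec₂.natPair.comp (.const 1) (Primrec₂.natPair.comp (.const l)
        (Primrec₂.natPair.comp (.const _) (Primrec.encode.comp (Primrec.list_ofFn hF))))
    · simp only [tmSubst, FirstOrder.Language.Term.subst, tmCode]
      simp only [← h]
      rfl

variable [∀ k, Encodable (L.Relations k)]

/-- For fixed `φ` only finitely many variable indices vary, so induction on `φ` composes pairings.
It is applied to the formulas that make up the translation. The context size `m` must be an argument
because quantifiers bind the variable numbered by it. -/
theorem primrec_code_rename {k : ℕ} (φ : Fm L k) :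
    ∃ F : ℕ → (Fin k → ℕ) → ℕ, Primrec₂ F ∧ ∀ (m : ℕ) (ρ : Fin k → Fin m),
      code (rename φ ρ) = F m fun i => ρ i := by
  induction φ with
  | falsum => exact ⟨fun _ _ => Nat.pair 0 0, Primrec₂.const _, fun m ρ => rfl⟩
  | equal t s =>
    obtain ⟨F, hF, h⟩ := primrec_tmCode_rename t
    obtain ⟨G, hG, h'⟩ := primrec_tmCode_rename s
    refine ⟨fun _ r => Nat.pair 1 (Nat.pair (F r) (G r)), ?_, fun m ρ => ?_⟩
    · exact Primrec₂.natPair.comp (.const 1)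
        (Primrec₂.natPair.comp (hF.comp .snd) (hG.comp .snd))
    · simp only [rename, subst, code, h, h']
  | @rel n l R ts =>
    choose F hF h using fun i => primrec_tmCode_rename (ts i)
    refine ⟨fun _ r => Nat.pair 2 (Nat.pair l (Nat.pair (Encodable.encode R)
      (Encodable.encode (List.ofFn fun i => F i r)))), ?_, fun m ρ => ?_⟩
    · exact Primrec₂.natPair.comp (.const 2) (Primrec₂.natPair.comp (.const l)
        (Primrec₂.natPair.comp (.const _)
          (Primrec.encode.comp (Primrec.list_ofFn fun i => (hF i).comp .snd))))
    · simp only [rename, subst, code, h]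
  | imp φ ψ ih ih' =>
    obtain ⟨F, hF, h⟩ := ih
    obtain ⟨G, hG, h'⟩ := ih'
    refine ⟨fun m r => Nat.pair 3 (Nat.pair (F m r) (G m r)),
      Primrec₂.natPair.comp (.const 3) (Primrec₂.natPair.comp hF hG), fun m ρ => ?_⟩
    simp only [← h, ← h']
    rfl
  | all φ ih =>
    obtain ⟨F, hF, h⟩ := ih
    -- The quantifier binds `x_m`, so under it the context grows by one and the renaming is extended
    -- by the value `m`.
    refine ⟨fun m r => Nat.pair 4 (F (m + 1) (Fin.snoc (α := fun _ => ℕ) r m)), ?_,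
      fun m ρ => ?_⟩
    · exact Primrec₂.natPair.comp (.const 4)
        (hF.comp (Primrec.succ.comp .fst) (primrec_snoc .snd .fst))
    · rw [rename_all, code, h]
      congr 2
      funext i
      refine Fin.lastCases ?_ (fun i => ?_) i <;> simp

/-- The code of `¬ φ` in terms of that of `φ`. -/
def codeNot (c : ℕ) : ℕ := Nat.pair 3 (Nat.pair c (Nat.pair 0 0))

/-- The code of `φ ⊓ ψ` in terms of those of `φ` and `ψ`. -/
def codeInf (c d : ℕ) : ℕ := codeNot (Nat.pair 3 (Nat.pair c (codeNot d)))

/-- The code of `∃ x φ` in terms of that of `φ`. -/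
def codeEx (c : ℕ) : ℕ := codeNot (Nat.pair 4 (codeNot c))

theorem code_inf {n : ℕ} (φ ψ : Fm L n) : code (φ ⊓ ψ) = codeInf (code φ) (code ψ) := rfl

theorem code_ex {n : ℕ} (φ : Fm L (n + 1)) : code φ.ex = codeEx (code φ) := rfl

theorem primrec_codeNot : Primrec codeNot :=
  Primrec₂.natPair.comp (.const 3) (Primrec₂.natPair.comp .id (.const _))

theorem primrec_codeInf : Primrec₂ codeInf :=
  primrec_codeNot.comp (Primrec₂.natPair.comp (.const 3)
    (Primrec₂.natPair.comp .fst (primrec_codeNot.comp .snd)))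

theorem primrec_codeEx : Primrec codeEx :=
  primrec_codeNot.comp (Primrec₂.natPair.comp (.const 4) primrec_codeNot)

/-- A function given by a recursion in which the parameter is increased is primitive recursive. -/
theorem primrec_of_shifted_recursion {G : ℕ → ℕ → ℕ} {C : ℕ → ℕ} {D : ℕ → ℕ → ℕ} (hC : Primrec C)
    (hD : Primrec₂ D) (h0 : ∀ m, G 0 m = C m) (hs : ∀ a m, G (a + 1) m = D m (G a (m + 1))) :
    Primrec₂ G := by
  -- The sum of the two arguments is invariant under the recursion. Starting from `C (m + a)`, stage
  -- `t` holds `G t (m + a - t)`, and stage `a` is the desired value.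
  have hK : Primrec fun p : ℕ × ℕ => Nat.rec (motive := fun _ => ℕ) (C (p.2 + p.1))
      (fun t v => D (p.2 + p.1 - (t + 1)) v) p.1 :=
    Primrec.nat_rec' (h := fun p q => D (p.2 + p.1 - (q.1 + 1)) q.2) .fst (hC.comp (Primrec.nat_add.comp .snd .fst))
      (Primrec₂.mk (hD.comp (Primrec.nat_sub.comp
        (Primrec.nat_add.comp (.comp .snd .fst) (.comp .fst .fst))
        (Primrec.succ.comp (.comp .fst .snd))) (.comp .snd .snd)))
  refine hK.of_eq fun ⟨a, m⟩ => ?_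
  have key : ∀ t ≤ a, Nat.rec (motive := fun _ => ℕ) (C (m + a))
      (fun t v => D (m + a - (t + 1)) v) t = G t (m + a - t) := by
    intro t
    induction t with
    | zero => intro _; exact (h0 _).symm
    | succ t ih =>
      intro ht
      change D (m + a - (t + 1)) _ = _
      rw [ih (by omega), hs, show m + a - (t + 1) + 1 = m + a - t by omega]
  simpa using key a le_rfl

/-! ### Codes of instances at interpreted numerals -/

variable (I : Translation numLang L)

theorem primrec_code_domAt_last :
    ∃ F : ℕ → ℕ, Primrec F ∧ ∀ m, code (I.domAt (Fin.last m)) = F m := by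
  obtain ⟨F, hF, h⟩ := primrec_code_rename I.dom
  refine ⟨fun m => F (m + 1) fun _ => m, hF.comp .succ (primrec_pi fun _ => .id), fun m => ?_⟩
  rw [Translation.domAt, h]
  congr 1
  funext i
  simp

theorem primrec_code_graph_numeral :
    ∃ G : ℕ → ℕ → ℕ, Primrec₂ G ∧ ∀ a m,
      code (I.graph (numeral a) Fin.elim0 (Fin.last m)) = G a m := by
  obtain ⟨A, hA, hA'⟩ := primrec_code_domAt_last I
  obtain ⟨Z, hZ, hZ'⟩ := primrec_code_rename (I.func (L₁ := numLang) NumFunc.zero)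
  obtain ⟨S, hS, hS'⟩ := primrec_code_rename (I.func (L₁ := numLang) NumFunc.succ)
  refine ⟨fun a m => code (I.graph (numeral a) Fin.elim0 (Fin.last m)), ?_, fun _ _ => rfl⟩
  refine primrec_of_shifted_recursion
    -- The code of `⊤` is the same in every context, so it is computed in `Fm L 0`.
    (C := fun m => codeInf (code (⊤ : Fm L 0)) (Z (m + 1) fun _ => m))
    (D := fun m c => codeEx (codeInf (codeInf (codeInf (A (m + 1)) c) (code (⊤ : Fm L 0)))
      (S (m + 2) ![m + 1, m]))) ?_ ?_ ?_ ?_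
  · exact primrec_codeInf.comp (.const _) (hZ.comp .succ (primrec_pi fun _ => .id))
  · exact primrec_codeEx.comp (primrec_codeInf.comp (primrec_codeInf.comp
      (primrec_codeInf.comp (hA.comp (Primrec.succ.comp .fst)) .snd) (.const _))
      (hS.comp (Primrec.succ.comp (Primrec.succ.comp .fst))
        (primrec_pi fun i => by fin_cases i; exacts [Primrec.succ.comp .fst, Primrec.fst])))
  · intro m
    rw [graph_numeral_zero, code_inf, hZ']
    rfl
  · intro a m
    rw [graph_numeral_succ, code_ex, code_inf, hS', code_inf, code_inf, hA']
    congr 3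
    funext i
    fin_cases i <;> rfl

theorem primrec_code_instNumeral (n : ℕ) :
    ∃ F : ℕ → ℕ → ℕ, Primrec₂ F ∧ ∀ (φ : Fm L (n + 1)) (a : ℕ),
      code (instNumeral I φ a) = F (code φ) a := by
  obtain ⟨G, hG, hG'⟩ := primrec_code_graph_numeral I
  refine ⟨fun c a => codeEx (codeInf (codeInf (code (I.domAt (Fin.last n))) (G a n)) c), ?_,
    fun φ a => ?_⟩
  · exact primrec_codeEx.comp (primrec_codeInf.comp (primrec_codeInf.comp (.const _)
      (hG.comp .snd (.const n))) .fst)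
  · rw [instNumeral, code_ex, code_inf, code_inf, hG']

theorem primrec_code_atNumerals (n : ℕ) :
    ∃ F : ℕ → (Fin n → ℕ) → ℕ, Primrec₂ F ∧ ∀ (φ : Fm L n) (a : Fin n → ℕ),
      code (n := 0) (atNumerals I φ a) = F (code φ) a := by
  induction n with
  | zero => exact ⟨fun c _ => c, Primrec.fst, fun φ a => rfl⟩
  | succ n ih =>
    obtain ⟨F, hF, h⟩ := ih
    obtain ⟨G, hG, h'⟩ := primrec_code_instNumeral I n
    refine ⟨fun c a => F (G c (a (Fin.last n))) fun i => a i.castSucc, ?_, fun φ a => ?_⟩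
    · exact hF.comp (hG.comp .fst ((primrec_apply _).comp .snd)) (primrec_init.comp .snd)
    · rw [atNumerals, h, h']

end Codes

/-! ### Substitution of numerals for the last variable -/

section Theories

variable {L : FirstOrder.Language.{u, v}}

/-- The added quantifier binds only the last variable. The chain of injections unfolds `∃` as `¬∀¬`
and `⊓` as `¬(· → ¬ ·)`. -/
theorem HasExactlyFree.instNumeral {n : ℕ} {φ : Fm L (n + 1)} (h : HasExactlyFree φ)
    (I : Translation numLang L) (a : ℕ) : HasExactlyFree (instNumeral I φ a) :=
  fun i => Or.inl (Or.inl (Or.inl (Or.inr (Or.inl (h i.castSucc)))))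

/-- Numerals are put for the last variable first, so fixing the last argument of a relation
corresponds to `instNumeral` on its separator. This is why parameters are placed at the end. -/
theorem atNumerals_snoc (I : Translation numLang L) {n : ℕ} (φ : Fm L (n + 1)) (a : Fin n → ℕ)
    (b : ℕ) : atNumerals I φ (Fin.snoc (α := fun _ => ℕ) a b) =
      atNumerals I (instNumeral I φ b) a := by
  rw [atNumerals]
  simp

theorem Consistent.not_provable_not {T : L.Theory} (hT : Consistent T) {σ : L.Sentence}
    (h : Provable T σ) : ¬ Provable T σ.not :=
  fun h' => hT (Derives.impE h' h)

variable {T : L.Theory} {I : Translation numLang L}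

/-- The section of a relation at a value of its last argument. -/
def lastSection {n : ℕ} (M : Set (Fin (n + 1) → ℕ)) (b : ℕ) : Set (Fin n → ℕ) :=
  {a | Fin.snoc (α := fun _ => ℕ) a b ∈ M}

theorem StronglySeparates.instNumeral {n : ℕ} {φ : Fm L (n + 1)} {M₁ M₂ : Set (Fin (n + 1) → ℕ)}
    (h : StronglySeparates T I φ M₁ M₂) (b : ℕ) :
    StronglySeparates T I (instNumeral I φ b) (lastSection M₁ b) (lastSection M₂ b) :=
  ⟨fun a ha => atNumerals_snoc I φ a b ▸ h.1 _ ha, fun a ha => atNumerals_snoc I φ a b ▸ h.2 _ ha⟩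

theorem ExactlySeparates.instNumeral {n : ℕ} {φ : Fm L (n + 1)} {M₁ M₂ : Set (Fin (n + 1) → ℕ)}
    (h : ExactlySeparates T I φ M₁ M₂) (b : ℕ) :
    ExactlySeparates T I (instNumeral I φ b) (lastSection M₁ b) (lastSection M₂ b) :=
  ⟨fun a => atNumerals_snoc I φ a b ▸ h.1 _, fun a => atNumerals_snoc I φ a b ▸ h.2 _⟩

theorem ExactlySeparates.stronglySeparates {n : ℕ} {φ : Fm L n} {M₁ M₂ N₁ N₂ : Set (Fin n → ℕ)}
    (h : ExactlySeparates T I φ N₁ N₂) (h₁ : M₁ \ M₂ ⊆ N₁) (h₂ : M₂ \ M₁ ⊆ N₂) :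
    StronglySeparates T I φ M₁ M₂ :=
  ⟨fun a ha => (h.1 a).1 (h₁ ha), fun a ha => (h.2 a).1 (h₂ ha)⟩

/-- The reduction principle for recursively enumerable relations. -/
theorem IsRE.exists_reduction {n : ℕ} {M₁ M₂ : Set (Fin n → ℕ)} (h₁ : IsRE M₁) (h₂ : IsRE M₂) :
    ∃ N₁ N₂ : Set (Fin n → ℕ), IsRE N₁ ∧ IsRE N₂ ∧ Disjoint N₁ N₂ ∧ N₁ ⊆ M₁ ∧ N₂ ⊆ M₂ ∧
      M₁ \ M₂ ⊆ N₁ ∧ M₂ \ M₁ ⊆ N₂ := by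
  obtain ⟨p, q, hp, hq, hp', hq', hd, h⟩ := REPred.exists_reduction h₁ h₂
  exact ⟨{a | p a}, {a | q a}, hp, hq, Set.disjoint_left.2 hd, hp', hq',
    fun a ha => (h a (Or.inl ha.1)).resolve_right fun h' => ha.2 (hq' a h'),
    fun a ha => (h a (Or.inr ha.1)).resolve_left fun h' => ha.2 (hp' a h')⟩

/-- If `M₁` and `M₂` are disjoint and `φ` strongly separates them even after its own refutable
and provable instances are added to them, then `φ` separates them exactly. -/
theorem StronglySeparates.exactlySeparates (hT : Consistent T) {n : ℕ} {φ : Fm L n}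
    {M₁ M₂ : Set (Fin n → ℕ)} (hd : Disjoint M₁ M₂)
    (h : StronglySeparates T I φ (M₁ ∪ {a | Provable T (atNumerals I φ a).not})
      (M₂ ∪ {a | Provable T (atNumerals I φ a)})) : ExactlySeparates T I φ M₁ M₂ := by
  have hcon : ∀ a, Provable T (atNumerals I φ a) → ¬ Provable T (atNumerals I φ a).not :=
    fun a => hT.not_provable_not
  have h₁ : ∀ a, a ∈ M₁ → a ∉ M₂ := fun a ha => Set.disjoint_left.1 hd ha
  have h₂ := h.1
  have h₃ := h.2
  simp only [Set.mem_sdiff, Set.mem_union, Set.mem_ofPred_eq] at h₂ h₃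
  -- At each fixed `a` the claim is propositional, in the four statements: membership in `M₁` or
  -- `M₂`, provability, refutability.
  constructor <;> intro a <;> have := hcon a <;> have := h₁ a <;> have := h₂ a <;>
    have := h₃ a <;> tauto

/-- An exact `n`-Rosser theory is `n`-Rosser. -/
theorem ExactNRosser.nRosser {n : ℕ} (h : ExactNRosser n T) : NRosser n T := by
  obtain ⟨I, hI, h⟩ := h
  refine ⟨I, hI, fun M₁ M₂ h₁ h₂ => ?_⟩
  obtain ⟨N₁, N₂, hN₁, hN₂, hd, -, -, hs₁, hs₂⟩ := h₁.exists_reduction h₂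
  obtain ⟨φ, hφ, hsep⟩ := h N₁ N₂ hN₁ hN₂ hd
  exact ⟨φ, hφ, hsep.stronglySeparates hs₁ hs₂⟩

/-! ### Effectiveness by parametrization, exactness by diagonalization -/

variable [∀ k, Encodable (L.Functions k)] [∀ k, Encodable (L.Relations k)]

theorem EffectivelyNRosser.nRosser {n : ℕ} {R : ℕ → Set (Fin n → ℕ)}
    (hR : IsAcceptableListing R) (h : EffectivelyNRosser R T) : NRosser n T := by
  obtain ⟨I, hI, f, -, h⟩ := h
  refine ⟨I, hI, fun M₁ M₂ h₁ h₂ => ?_⟩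
  obtain ⟨i, rfl⟩ := hR.exists_eq h₁
  obtain ⟨j, rfl⟩ := hR.exists_eq h₂
  obtain ⟨φ, -, hφ⟩ := h i j
  exact ⟨φ, hφ⟩

theorem EffectivelyExactNRosser.exactNRosser {n : ℕ} {R : ℕ → Set (Fin n → ℕ)}
    (hR : IsAcceptableListing R) (h : EffectivelyExactNRosser R T) : ExactNRosser n T := by
  obtain ⟨I, hI, f, -, h⟩ := h
  refine ⟨I, hI, fun M₁ M₂ h₁ h₂ hd => ?_⟩
  obtain ⟨i, rfl⟩ := hR.exists_eq h₁
  obtain ⟨j, rfl⟩ := hR.exists_eq h₂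
  obtain ⟨φ, -, hφ⟩ := h i j hd
  exact ⟨φ, hφ⟩

/-- The relations `a ∈ R i` and `a ∈ R j` between `a`, `i` and `j`. -/
theorem IsAcceptableListing.exists_universal {n : ℕ} {R : ℕ → Set (Fin n → ℕ)}
    (hR : IsAcceptableListing R) :
    ∃ U₁ U₂ : Set (Fin (n + 2) → ℕ), IsRE U₁ ∧ IsRE U₂ ∧
      ∀ i j, lastSection (lastSection U₁ j) i = R i ∧ lastSection (lastSection U₂ j) i = R j := by
  have hinit : Computable fun (a : Fin (n + 2) → ℕ) (i : Fin n) => a i.castSucc.castSucc :=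
    (primrec_init.comp primrec_init).to_comp
  refine ⟨{a | (fun i : Fin n => a i.castSucc.castSucc) ∈ R (a (Fin.last n).castSucc)},
    {a | (fun i : Fin n => a i.castSucc.castSucc) ∈ R (a (Fin.last (n + 1)))},
    (REPred.comp hR.uniformly_re ((primrec_apply _).to_comp.pair hinit) :),
    (REPred.comp hR.uniformly_re ((primrec_apply _).to_comp.pair hinit) :), fun i j => ⟨?_, ?_⟩⟩ <;>
  · ext a
    simp [lastSection]

/-- The formula is fixed and only the two numerals vary; this supplies the recursive function in
both effective notions. -/
theorem computable_code_instNumeral₂ (I : Translation numLang L) {n : ℕ} (φ : Fm L (n + 2)) :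
    Computable₂ fun i j => code (instNumeral I (instNumeral I φ j) i) := by
  obtain ⟨F, hF, h⟩ := primrec_code_instNumeral I n
  obtain ⟨G, hG, h'⟩ := primrec_code_instNumeral I (n + 1)
  simp only [h, h']
  exact (hF.comp (hG.comp (.const _) .snd) .fst).to_comp

/-- An `(n + 2)`-Rosser theory is effectively `n`-Rosser. -/
theorem NRosser.effectivelyNRosser {n : ℕ} {R : ℕ → Set (Fin n → ℕ)}
    (hR : IsAcceptableListing R) (h : NRosser (n + 2) T) : EffectivelyNRosser R T := by
  obtain ⟨I, hI, h⟩ := h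
  obtain ⟨U₁, U₂, hU₁, hU₂, hU⟩ := hR.exists_universal
  obtain ⟨φ, hφ, hsep⟩ := h U₁ U₂ hU₁ hU₂
  refine ⟨I, hI, _, computable_code_instNumeral₂ I φ, fun i j =>
    ⟨_, rfl, (hφ.instNumeral I j).instNumeral I i, ?_⟩⟩
  have := (hsep.instNumeral j).instNumeral i
  rwa [(hU i j).1, (hU i j).2] at this

/-- An exact `(n + 2)`-Rosser theory is effectively exact `n`-Rosser. -/
theorem ExactNRosser.effectivelyExactNRosser {n : ℕ} {R : ℕ → Set (Fin n → ℕ)}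
    (hR : IsAcceptableListing R) (h : ExactNRosser (n + 2) T) : EffectivelyExactNRosser R T := by
  obtain ⟨I, hI, h⟩ := h
  obtain ⟨U₁, U₂, hU₁, hU₂, hU⟩ := hR.exists_universal
  -- `U₁` and `U₂` overlap, because not all pairs of indices name disjoint relations, so they cannot
  -- be separated exactly as they stand.
  obtain ⟨N₁, N₂, hN₁, hN₂, hd, hs₁, hs₂, ht₁, ht₂⟩ := hU₁.exists_reduction hU₂
  obtain ⟨φ, hφ, hsep⟩ := h N₁ N₂ hN₁ hN₂ hd
  refine ⟨I, hI, _, computable_code_instNumeral₂ I φ, fun i j hij =>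
    ⟨_, rfl, (hφ.instNumeral I j).instNumeral I i, ?_⟩⟩
  have := (hsep.instNumeral j).instNumeral i
  rw [← (hU i j).1, ← (hU i j).2] at hij ⊢
  convert this using 1
  -- Reduction removes points only from the overlap, and these sections have none.
  · exact Set.Subset.antisymm (fun a ha => ht₁ ⟨ha, Set.disjoint_left.1 hij ha⟩)
      fun a ha => hs₁ ha
  · exact Set.Subset.antisymm (fun a ha => ht₂ ⟨ha, Set.disjoint_right.1 hij ha⟩)
      fun a ha => hs₂ ha

/-- The relation `T ⊢ θ(a, e)` between `a` and the code `e` of `θ` is recursively enumerable, and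
so is `T ⊢ ¬ θ(a, e)`. -/
theorem IsRETheory.exists_diagonal (hT : IsRETheory T) (I : Translation numLang L) (n : ℕ) :
    ∃ D₁ D₂ : Set (Fin (n + 1) → ℕ), IsRE D₁ ∧ IsRE D₂ ∧ ∀ θ : Fm L (n + 1),
      lastSection D₁ (code θ) =
          {a | Provable T (atNumerals I (instNumeral I θ (code θ)) a)} ∧
        lastSection D₂ (code θ) =
          {a | Provable T (atNumerals I (instNumeral I θ (code θ)) a).not} := by
  obtain ⟨F, hF, h⟩ := primrec_code_atNumerals I (n + 1)
  -- The diagonal: the last argument is read as the code of the formula and is also substituted into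
  -- it.
  have hF' : Primrec fun a : Fin (n + 1) → ℕ => F (a (Fin.last n)) a :=
    hF.comp (primrec_apply _) .id
  have hcode : ∀ σ : L.Sentence,
      (∃ τ : L.Sentence, Provable T τ ∧ code (n := 0) τ = code (n := 0) σ) ↔ Provable T σ :=
    fun σ => ⟨fun ⟨τ, hτ, hc⟩ => code_injective hc ▸ hτ, fun hσ => ⟨σ, hσ, rfl⟩⟩
  refine ⟨{a | ∃ σ : L.Sentence, Provable T σ ∧ code (n := 0) σ = F (a (Fin.last n)) a},
    {a | ∃ σ : L.Sentence, Provable T σ ∧ code (n := 0) σ = codeNot (F (a (Fin.last n)) a)},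
    (REPred.comp hT hF'.to_comp :), (REPred.comp hT (primrec_codeNot.comp hF').to_comp :),
    fun θ => ⟨?_, ?_⟩⟩
  · ext a
    simp only [lastSection, Set.mem_ofPred_eq, Fin.snoc_last]
    rw [← h, hcode, atNumerals_snoc]
  · ext a
    simp only [lastSection, Set.mem_ofPred_eq, Fin.snoc_last]
    rw [← h, ← atNumerals_snoc]
    -- `codeNot` applied to a code is definitionally the code of the negation.
    exact hcode (atNumerals I θ (Fin.snoc (α := fun _ => ℕ) a (code θ))).not

/-- A consistent RE theory that is `(n + 1)`-Rosser is exact `n`-Rosser. -/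
theorem NRosser.exactNRosser {n : ℕ} (hcons : Consistent T) (hre : IsRETheory T)
    (h : NRosser (n + 1) T) : ExactNRosser n T := by
  obtain ⟨I, hI, h⟩ := h
  refine ⟨I, hI, fun M₁ M₂ h₁ h₂ hd => ?_⟩
  obtain ⟨D₁, D₂, hD₁, hD₂, hD⟩ := hre.exists_diagonal I n
  have hinit : Computable fun (a : Fin (n + 1) → ℕ) (i : Fin n) => a i.castSucc :=
    primrec_init.to_comp
  -- The sets are crossed: refutable instances join the side to be proved, provable ones the side to
  -- be refuted.
  obtain ⟨θ, hθ, hsep⟩ := h ({a | (fun i : Fin n => a i.castSucc) ∈ M₁} ∪ D₂)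
    ({a | (fun i : Fin n => a i.castSucc) ∈ M₂} ∪ D₁)
    (REPred.or (REPred.comp h₁ hinit :) hD₂) (REPred.or (REPred.comp h₂ hinit :) hD₁)
  refine ⟨instNumeral I θ (code θ), hθ.instNumeral I _,
    StronglySeparates.exactlySeparates hcons hd ?_⟩
  rw [← (hD θ).1, ← (hD θ).2]
  convert hsep.instNumeral (code θ) using 1 <;>
  · ext a
    simp [lastSection]

end Theories

end Rosser

theorem mainTheorem1 {L : FirstOrder.Language.{u, v}} [∀ k, Encodable (L.Functions k)]
    [∀ k, Encodable (L.Relations k)] (T : L.Theory) (hcons : Rosser.Consistent T)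
    (hre : Rosser.IsRETheory T) (R : (n : ℕ) → ℕ → Set (Fin n → ℕ))
    (hR : ∀ n, 1 ≤ n → Rosser.IsAcceptableListing (R n)) :
    List.TFAE [Rosser.IsRosser T, Rosser.IsEffectivelyRosser R T, Rosser.IsExactRosser T,
      Rosser.IsEffectivelyExactRosser R T] := by
  -- Two extra arguments hold the indices `i` and `j`; in 1 → 3 one extra argument holds the code of
  -- the separator.
  tfae_have 1 → 2 := fun h n hn => (h (n + 2) (by omega)).effectivelyNRosser (hR n hn)
  tfae_have 2 → 1 := fun h n hn => (h n hn).nRosser (hR n hn)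
  tfae_have 1 → 3 := fun h n _ => (h (n + 1) (by omega)).exactNRosser hcons hre
  tfae_have 3 → 1 := fun h n hn => (h n hn).nRosser
  tfae_have 3 → 4 := fun h n hn => (h (n + 2) (by omega)).effectivelyExactNRosser (hR n hn)
  tfae_have 4 → 3 := fun h n hn => (h n hn).exactNRosser (hR n hn)
  tfae_finish
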